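/- Let $\mathbf k$ be a field of characteristic $0$ with pairwise commuting derivations $\delta_1,\dots,\delta_m$ ($m\ge 0$), and let $\mathbf k\{y_1,\dots,y_n\}$ be the ring of differential polynomials, i.e. the polynomial ring over $\mathbf k$ in the derivatives $\Theta Y=\{\theta y_j\}$, where $\theta$ runs over the monoid $\Theta$ of derivative operators $\delta_1^{k_1}\cdots\delta_m^{k_m}$. Fix a ranking $\le$, that is, a total order on $\Theta Y$ such that $u\le\theta u$, and $v\le u$ implies $\theta v\le\theta u$, for all $\theta\in\Theta$ and $u,v\in\Theta Y$. The leader of a polynomial $f\notin\mathbf k$ is the highest derivative $u$ appearing in $f$, and its rank is $u^d$ with $d=\deg_u f$; ranks are compared first by $u$, then by $d$. We say that $f$ is algebraically reduced w.r.t. $g\notin\mathbf k$ with leader $u$ if $\deg_u f<\deg_u g$, and reduced w.r.t. $g$ if moreover no proper derivative $\theta u$, $\theta\ne 1$, appears in $f$. A set of polynomials outside $\mathbf k$ is (algebraically) autoreduced if each element is (algebraically) reduced w.r.t. all the others. Such a set $\mathbb A$ has lower rank than another one $\mathbb B$ if, at the first place where the increasing lists of ranks of their elements differ, $\mathbb A$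 has the smaller rank, or the list of $\mathbb B$ has ended and that of $\mathbb A$ has not. A characteristic set (respectively, an algebraic characteristic set) of a set $X$ of polynomials is an autoreduced (respectively, algebraically autoreduced) subset of $X$ of the lowest rank. (1) Let $P\subseteq Q$ be prime differential ideals of $\mathbf k\{y_1,\dots,y_n\}$, and let $\mathbb C_1$, $\mathbb C_2$ be characteristic sets of $P$, $Q$ w.r.t. $\le$. If $\mathbb C_1$ and $\mathbb C_2$ have the same set of leaders, then $P=Q$. (2) Let $V\subseteq\Theta Y$ be any set of derivatives, ordered by $\le$, let $P\subseteq Q$ be prime ideals of the polynomial ring $\mathbf k[V]$, and let $\mathbb C_1$, $\mathbb C_2$ be algebraic characteristic sets of $P$, $Q$ w.r.t. $\le$. If $\mathbb C_1$ and $\mathbb C_2$ have the same set of leaders, then $P=Q$. -/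

import Mathlib

noncomputable section

namespace DiffAlg

open MvPolynomial

/-! ### Derivatives and differential polynomials -/

/-- The derivatives `θ y_j`, where `θ = δ_1^{k_1} ⋯ δ_m^{k_m}` is a derivative operator, given by
its vector of exponents `op = (k_1, …, k_m)`, and `y_j` (with `j = var`) is one of the `n`
differential indeterminates. -/
@[ext]
structure DVar (m n : ℕ) where
  /-- the exponent vector of the derivative operator -/
  op : Fin m →₀ ℕ
  /-- the index of the differential indeterminate -/
  var : Fin n

/-- The action `θ₁ (θ₂ y_j) = (θ₁ θ₂) y_j` of derivative operators on derivatives. The monoid of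
derivative operators is written additively, through exponent vectors. -/
def DVar.act {m n : ℕ} (θ : Fin m →₀ ℕ) (u : DVar m n) : DVar m n := ⟨θ + u.op, u.var⟩

/-- The ring `k{y_1, …, y_n}` of differential polynomials, with `m` derivations. -/
abbrev DiffPoly (m n : ℕ) (k : Type*) [CommRing k] : Type _ := MvPolynomial (DVar m n) k

section Derivation

variable {σ k : Type*} [CommRing k]

/-- Application of a derivation of `k` to all coefficients of a polynomial. -/
def coeffDeriv (d : Derivation ℤ k k) (f : MvPolynomial σ k) : MvPolynomial σ k :=
  ∑ s ∈ f.support, monomial s (d (coeff s f))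

theorem coeff_coeffDeriv (d : Derivation ℤ k k) (f : MvPolynomial σ k) (s : σ →₀ ℕ) :
    coeff s (coeffDeriv d f) = d (coeff s f) := by
  classical
  simp only [coeffDeriv, coeff_sum, coeff_monomial, Finset.sum_ite_eq', mem_support_iff]
  split_ifs with h
  · rfl
  · simp [not_not.mp h]

theorem coeffDeriv_add (d : Derivation ℤ k k) (f g : MvPolynomial σ k) :
    coeffDeriv d (f + g) = coeffDeriv d f + coeffDeriv d g := by
  ext s
  simp [coeff_coeffDeriv]

theorem coeffDeriv_monomial (d : Derivation ℤ k k) (s : σ →₀ ℕ) (a : k) :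
    coeffDeriv d (monomial s a) = monomial s (d a) := by
  classical
  ext t
  simp only [coeff_coeffDeriv, coeff_monomial]
  split_ifs <;> simp

theorem coeffDeriv_mul (d : Derivation ℤ k k) (f g : MvPolynomial σ k) :
    coeffDeriv d (f * g) = f * coeffDeriv d g + g * coeffDeriv d f := by
  induction f using MvPolynomial.induction_on' with
  | add p q hp hq => simp only [add_mul, mul_add, coeffDeriv_add, hp, hq]; ring
  | monomial s a =>
    induction g using MvPolynomial.induction_on' with
    | add p q hp hq => simp only [add_mul, mul_add, coeffDeriv_add, hp, hq]; ring
    | monomial t b =>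
      simp only [monomial_mul, coeffDeriv_monomial, Derivation.leibniz, smul_eq_mul, map_add]
      rw [add_comm t s]

/-- `coeffDeriv` as a derivation. -/
def coeffDerivation (d : Derivation ℤ k k) :
    Derivation ℤ (MvPolynomial σ k) (MvPolynomial σ k) :=
  Derivation.mk' (AddMonoidHom.mk' (coeffDeriv d) (coeffDeriv_add d)).toIntLinearMap
    (fun f g => by simpa using coeffDeriv_mul d f g)

end Derivation

section Differential

variable {m n : ℕ} {k : Type*} [CommRing k]

/-- The derivation `δ_i` of `k{y_1, …, y_n}`: it extends the derivation `D i` of `k` and maps each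
derivative `u` to `δ_i u`. -/
def delta (D : Fin m → Derivation ℤ k k) (i : Fin m) :
    Derivation ℤ (DiffPoly m n k) (DiffPoly m n k) :=
  coeffDerivation (D i) +
    (mkDerivation k fun u : DVar m n => X (u.act (Finsupp.single i 1))).restrictScalars ℤ

theorem delta_C (D : Fin m → Derivation ℤ k k) (i : Fin m) (a : k) :
    delta D i (C a : DiffPoly m n k) = C (D i a) := by
  change coeffDeriv (D i) (monomial 0 a) + mkDerivation k _ (C a) = _
  rw [coeffDeriv_monomial, ← algebraMap_eq, Derivation.map_algebraMap, add_zero]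
  rfl

theorem delta_X (D : Fin m → Derivation ℤ k k) (i : Fin m) (u : DVar m n) :
    delta D i (X u : DiffPoly m n k) = X (u.act (Finsupp.single i 1)) := by
  change coeffDeriv (D i) (monomial _ 1) + mkDerivation k _ (X u) = _
  rw [coeffDeriv_monomial, mkDerivation_X]
  simp

/-- An ideal of `k{y_1, …, y_n}` is differential if it is stable under all the `δ_i`. -/
def IsDifferentialIdeal (D : Fin m → Derivation ℤ k k) (I : Ideal (DiffPoly m n k)) : Prop :=
  ∀ i : Fin m, ∀ f ∈ I, delta D i f ∈ I

end Differential

/-- A ranking: a total order on the derivatives with `θ u ≥ u` and `u ≥ v → θ u ≥ θ v`. -/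
def IsRanking (m n : ℕ) [LinearOrder (DVar m n)] : Prop :=
  (∀ (θ : Fin m →₀ ℕ) (u : DVar m n), u ≤ u.act θ) ∧
    ∀ (θ : Fin m →₀ ℕ) (u v : DVar m n), v ≤ u → v.act θ ≤ u.act θ

/-! ### Leaders, ranks, reducedness -/

section Rank

variable {σ k : Type*} [LinearOrder σ] [CommRing k]

/-- `u` is the leader of `f`: the highest variable appearing in `f`. An `f` in `k` has none. -/
def IsLeader (f : MvPolynomial σ k) (u : σ) : Prop := IsGreatest {v | v ∈ f.vars} u

/-- The set of leaders of the elements of `A`. -/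
def leaders (A : Set (MvPolynomial σ k)) : Set σ := {u | ∃ f ∈ A, IsLeader f u}

/-- The set of ranks of the elements of `A`; the rank `u ^ d`, where `u` is the leader of `f` and
`d` is the degree of `f` in `u`, is encoded as the pair `(u, d)`. -/
def ranks (A : Set (MvPolynomial σ k)) : Set (σ × ℕ) :=
  {r | ∃ f ∈ A, IsLeader f r.1 ∧ f.degreeOf r.1 = r.2}

/-- Comparison of ranks: `u₁ ^ d₁ < u₂ ^ d₂` iff `u₁ < u₂`, or `u₁ = u₂` and `d₁ < d₂`. -/
def RankLT (r s : σ × ℕ) : Prop := r.1 < s.1 ∨ r.1 = s.1 ∧ r.2 < s.2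

/-- `A` has lower rank than `B`, for (algebraically) autoreduced sets, whose elements have pairwise
distinct leaders: at the first place where the increasing lists of the ranks of `A` and of `B`
differ, either `A` has the smaller rank `r`, or the list of `B` has ended and that of `A` goes on
with `r`. -/
def LowerRank (A B : Set (MvPolynomial σ k)) : Prop :=
  ∃ r ∈ ranks A, r ∉ ranks B ∧ ∀ s, RankLT s r → (s ∈ ranks A ↔ s ∈ ranks B)

/-- `f` is algebraically reduced w.r.t. `g`: its degree in the leader of `g` is smaller than that
of `g`. -/
def IsAlgReduced (f g : MvPolynomial σ k) : Prop :=
  ∀ u, IsLeader g u → f.degreeOf u < g.degreeOf u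

/-- `A` consists of polynomials outside `k`, each of which is reduced, in the sense of `red`,
w.r.t. all the others. -/
def IsAutoreducedFor (red : MvPolynomial σ k → MvPolynomial σ k → Prop)
    (A : Set (MvPolynomial σ k)) : Prop :=
  (∀ f ∈ A, f ∉ Set.range (C : k → MvPolynomial σ k)) ∧ ∀ f ∈ A, ∀ g ∈ A, f ≠ g → red f g

/-- `A` is a subset of `S` of the lowest rank among those autoreduced in the sense of `red`. -/
def IsCharSetFor (red : MvPolynomial σ k → MvPolynomial σ k → Prop)
    (A S : Set (MvPolynomial σ k)) : Prop :=
  A ⊆ S ∧ IsAutoreducedFor red A ∧ ∀ B ⊆ S, IsAutoreducedFor red B → ¬ LowerRank B A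

/-- `A` is an algebraic characteristic set of `S`: an algebraically autoreduced subset of the
lowest rank. -/
def IsAlgCharSet (A S : Set (MvPolynomial σ k)) : Prop := IsCharSetFor IsAlgReduced A S

end Rank

section DifferentialRank

variable {m n : ℕ} [LinearOrder (DVar m n)] {k : Type*} [CommRing k]

/-- `f` is partially reduced w.r.t. `g`: no proper derivative of the leader of `g` appears in
`f`. -/
def IsPartiallyReduced (f g : DiffPoly m n k) : Prop :=
  ∀ u, IsLeader g u → ∀ θ : Fin m →₀ ℕ, θ ≠ 0 → u.act θ ∉ f.vars

/-- `f` is reduced w.r.t. `g`: partially and algebraically reduced. -/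
def IsReduced (f g : DiffPoly m n k) : Prop := IsPartiallyReduced f g ∧ IsAlgReduced f g

/-- `A` is a (differential) characteristic set of `S`: an autoreduced subset of the lowest
rank. -/
def IsCharSet (A S : Set (DiffPoly m n k)) : Prop := IsCharSetFor IsReduced A S

end DifferentialRank

end DiffAlg

end

/-!
Let `N` be the set of variables that are not leaders of `C₁` (nor derivatives of such leaders). The
separant of an element of `C₁` is reduced with respect to `C₁` and nonzero, hence not in `P`; and
`δ_i f` is linear in `δ_i u`, with the separant of `f` as coefficient, when `u` is the leader of
`f`. So every variable outside `N` is algebraic modulo `P` over the smaller ones. As the variables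
are well-ordered, `k[V] / P` is algebraic over `k[N]`. If `P ≠ Q`, then an element of `Q` outside
`P` has, modulo `P`, a nonzero multiple in `k[N]`. This multiple lies in `Q` and is reduced with
respect to `C₂`, so it is zero, a contradiction.
-/

namespace DiffAlg

open MvPolynomial

section PDeriv

variable {σ k : Type*} [CommSemiring k]

theorem degreeOf_pderiv_le (u v : σ) (f : MvPolynomial σ k) :
    (pderiv u f).degreeOf v ≤ f.degreeOf v := by
  rw [degreeOf_le_iff]
  intro s hs
  rw [mem_support_iff, coeff_pderiv] at hs
  have hle := monomial_le_degreeOf v (mem_support_iff.2 (left_ne_zero_of_mul hs))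
  exact (Nat.le_add_right _ _).trans hle

theorem vars_pderiv_subset (u : σ) (f : MvPolynomial σ k) : (pderiv u f).vars ⊆ f.vars := by
  intro v hv
  rw [mem_vars_iff_degreeOf_ne_zero] at hv ⊢
  exact ((Nat.pos_of_ne_zero hv).trans_le (degreeOf_pderiv_le u v f)).ne'

theorem degreeOf_pderiv_lt {u : σ} {f : MvPolynomial σ k} (hu : u ∈ f.vars) :
    (pderiv u f).degreeOf u < f.degreeOf u := by
  rw [degreeOf_lt_iff (Nat.pos_of_ne_zero (mem_vars_iff_degreeOf_ne_zero.1 hu))]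
  intro s hs
  rw [mem_support_iff, coeff_pderiv] at hs
  have hle := monomial_le_degreeOf u (mem_support_iff.2 (left_ne_zero_of_mul hs))
  rwa [Finsupp.add_apply, Finsupp.single_eq_same] at hle

theorem pderiv_ne_zero_of_mem_vars [NoZeroDivisors k] [CharZero k] {u : σ}
    {f : MvPolynomial σ k} (hu : u ∈ f.vars) : pderiv u f ≠ 0 := by
  obtain ⟨s, hs, hsu⟩ := (mem_vars_iff_mem_support u).1 hu
  have hle : Finsupp.single u 1 ≤ s :=
    Finsupp.single_le_iff.2 (Nat.one_le_iff_ne_zero.2 (Finsupp.mem_support_iff.1 hsu))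
  have hcoeff := coeff_pderiv (i := u) f (s - Finsupp.single u 1)
  rw [tsub_add_cancel_of_le hle] at hcoeff
  refine ne_zero_iff.2 ⟨s - Finsupp.single u 1, ?_⟩
  rw [hcoeff]
  exact mul_ne_zero (mem_support_iff.1 hs) (Nat.cast_add_one_ne_zero _)

theorem derivative_aeval_update_X [DecidableEq σ] {S : Type*} [CommSemiring S] [Algebra k S]
    (s : σ → S) (v : σ) (f : MvPolynomial σ k) :
    Polynomial.derivative (aeval (Function.update (fun w => Polynomial.C (s w)) v .X) f) =
      aeval (Function.update (fun w => Polynomial.C (s w)) v .X) (pderiv v f) := by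
  induction f using MvPolynomial.induction_on with
  | C a => simp [Polynomial.algebraMap_apply]
  | add p q hp hq => simp only [map_add, hp, hq]
  | mul_X p w hp =>
    obtain rfl | hwv := eq_or_ne w v
    · simp only [map_mul, map_add, Polynomial.derivative_mul, pderiv_mul, hp, aeval_X,
        Function.update_self, Polynomial.derivative_X, pderiv_X_self, map_one]
    · simp only [map_mul, map_add, Polynomial.derivative_mul, pderiv_mul, hp, aeval_X,
        Function.update_of_ne hwv, Polynomial.derivative_C, pderiv_X_of_ne hwv, map_zero]

theorem aeval_aeval_update_X [DecidableEq σ] {S A : Type*} [CommSemiring S] [Algebra k S]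
    [CommSemiring A] [Algebra k A] [Algebra S A] [IsScalarTower k S A] (s : σ → S) (v : σ) (y : A)
    (f : MvPolynomial σ k) :
    Polynomial.aeval y (aeval (Function.update (fun w => Polynomial.C (s w)) v .X) f) =
      aeval (Function.update (fun w => algebraMap S A (s w)) v y) f := by
  induction f using MvPolynomial.induction_on with
  | C a => simp [Polynomial.algebraMap_apply, ← IsScalarTower.algebraMap_apply]
  | add p q hp hq => simp only [map_add, hp, hq]
  | mul_X p w hp =>
    obtain rfl | hwv := eq_or_ne w v
    · simp only [map_mul, hp, aeval_X, Function.update_self, Polynomial.aeval_X]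
    · simp only [map_mul, hp, aeval_X, Function.update_of_ne hwv, Polynomial.aeval_C]

end PDeriv

section Algebraic

theorem isAlgebraic_of_aeval_pderiv_ne_zero {σ k R A : Type*} [CommRing k] [CommRing R]
    [IsDomain R] [CommRing A] [NoZeroDivisors A] [Algebra k R] [Algebra k A] [Algebra R A]
    [IsScalarTower k R A] {x : σ → A} {f : MvPolynomial σ k} {v : σ}
    (hx : ∀ w ∈ f.vars, w ≠ v → IsAlgebraic R (x w)) (hf : aeval x f = 0)
    (hsep : aeval x (pderiv v f) ≠ 0) : IsAlgebraic R (x v) := by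
  classical
  let S := Subalgebra.algebraicClosure R A
  let s : σ → S := fun w => if h : IsAlgebraic R (x w) then ⟨x w, h⟩ else 0
  let F : Polynomial S := aeval (Function.update (fun w => Polynomial.C (s w)) v .X) f
  have aeval_eq : ∀ g : MvPolynomial σ k, g.vars ⊆ f.vars →
      aeval (Function.update (fun w => algebraMap S A (s w)) v (x v)) g = aeval x g := by
    refine fun g hg => eval₂Hom_congr' rfl (fun w hw _ => ?_) rfl
    obtain rfl | hwv := eq_or_ne w v
    · exact Function.update_self ..
    · rw [Function.update_of_ne hwv]
      simp only [s, dif_pos (hx w (hg hw) hwv)]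
      rfl
  have hF : Polynomial.aeval (x v) F = 0 := by
    rw [aeval_aeval_update_X, aeval_eq f subset_rfl, hf]
  have hF' : Polynomial.aeval (x v) (Polynomial.derivative F) ≠ 0 := by
    rwa [derivative_aeval_update_X, aeval_aeval_update_X, aeval_eq _ (vars_pderiv_subset v f)]
  have hF0 : F ≠ 0 := fun h => hF' (by rw [h, Polynomial.derivative_zero, map_zero])
  have hS : IsAlgebraic S (x v) := ⟨F, hF0, hF⟩
  exact hS.restrictScalars R

theorem eq_of_le_of_isAlgebraic_quotient {R A : Type*} [CommRing R] [CommRing A] [Algebra R A]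
    {P Q : Ideal A} [P.IsPrime] [Algebra.IsAlgebraic R (A ⧸ P)] (hPQ : P ≤ Q)
    (hQ : Q.comap (algebraMap R A) = ⊥) : P = Q := by
  refine hPQ.antisymm fun g hg => by_contra fun hgP => ?_
  have hg0 : Ideal.Quotient.mk P g ≠ 0 := by rwa [Ne, Ideal.Quotient.eq_zero_iff_mem]
  refine Ideal.comap_ne_bot_of_algebraic_mem (R := R) hg0 (Ideal.mem_map_of_mem _ hg)
    (Algebra.IsAlgebraic.isAlgebraic _) ?_
  rw [IsScalarTower.algebraMap_eq R A (A ⧸ P), ← Ideal.comap_comap, Ideal.Quotient.algebraMap_eq,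
    Ideal.comap_map_mk hPQ, hQ]

variable {σ k : Type*} [LinearOrder σ] [WellFoundedLT σ] [CommRing k] [IsDomain k]

theorem isAlgebraic_quotient_of_pderiv_notMem {P : Ideal (MvPolynomial σ k)} [P.IsPrime]
    (N : Set σ) (hP : ∀ v ∉ N, ∃ f ∈ P, f ∈ supported k (Set.Iic v) ∧ pderiv v f ∉ P) :
    Algebra.IsAlgebraic (supported k N) (MvPolynomial σ k ⧸ P) := by
  let x : σ → MvPolynomial σ k ⧸ P := fun v => Ideal.Quotient.mk P (X v)
  have aeval_x : ∀ f, aeval x f = Ideal.Quotient.mk P f := fun f =>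
    (comp_aeval_apply X (Ideal.Quotient.mkₐ k P) f).symm.trans (by rw [aeval_X_left_apply]; rfl)
  have hx : ∀ v, IsAlgebraic (supported k N) (x v) := by
    intro v
    induction v using WellFoundedLT.induction with
    | ind v ih =>
      by_cases hv : v ∈ N
      · exact isAlgebraic_algebraMap (⟨X v, X_mem_supported.2 hv⟩ : supported k N)
      · obtain ⟨f, hfP, hfv, hsep⟩ := hP v hv
        refine isAlgebraic_of_aeval_pderiv_ne_zero (f := f)
          (fun w hw hwv => ih w ((mem_supported.1 hfv hw).lt_of_ne hwv)) ?_ ?_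
        · rwa [aeval_x, Ideal.Quotient.eq_zero_iff_mem]
        · rwa [aeval_x, Ne, Ideal.Quotient.eq_zero_iff_mem]
  refine ⟨fun y => ?_⟩
  obtain ⟨f, rfl⟩ := Ideal.Quotient.mk_surjective y
  induction f using MvPolynomial.induction_on with
  | C a => exact isAlgebraic_algebraMap (algebraMap k (supported k N) a)
  | add p q hp hq => rw [map_add]; exact hp.add hq
  | mul_X p v hp => rw [map_mul]; exact hp.mul (hx v)

theorem eq_of_le_of_pderiv_notMem {P Q : Ideal (MvPolynomial σ k)} [P.IsPrime] (hPQ : P ≤ Q)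
    (N : Set σ) (hP : ∀ v ∉ N, ∃ f ∈ P, f ∈ supported k (Set.Iic v) ∧ pderiv v f ∉ P)
    (hQ : ∀ f ∈ Q, f ∈ supported k N → f = 0) : P = Q := by
  have := isAlgebraic_quotient_of_pderiv_notMem N hP
  refine eq_of_le_of_isAlgebraic_quotient (R := supported k N) hPQ ?_
  exact (Submodule.eq_bot_iff _).2 fun r hr => Subtype.ext (hQ r hr r.2)

end Algebraic

section Leader

variable {σ k : Type*} [LinearOrder σ] [CommRing k] {f g : MvPolynomial σ k} {u v : σ}

theorem IsLeader.eq (hu : IsLeader f u) (hv : IsLeader f v) : u = v :=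
  IsGreatest.unique hu hv

theorem IsLeader.degreeOf_pos (hu : IsLeader f u) : 0 < f.degreeOf u :=
  Nat.pos_of_ne_zero (mem_vars_iff_degreeOf_ne_zero.1 hu.1)

theorem IsLeader.degreeOf_eq_zero (hu : IsLeader f u) (huv : u < v) : f.degreeOf v = 0 :=
  by_contra fun h => huv.not_ge (hu.2 (mem_vars_iff_degreeOf_ne_zero.2 h))

theorem IsLeader.mem_supported (hu : IsLeader f u) : f ∈ supported k (Set.Iic u) :=
  MvPolynomial.mem_supported.2 fun _ hv => hu.2 hv

theorem IsLeader.notMem_range_C (hu : IsLeader f u) :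
    f ∉ Set.range (C : k → MvPolynomial σ k) := by
  rintro ⟨a, rfl⟩
  exact Finset.notMem_empty u (vars_C (R := k) (r := a) ▸ hu.1)

theorem exists_isLeader (hf : f ∉ Set.range (C : k → MvPolynomial σ k)) :
    ∃ u, IsLeader f u := by
  have hne : f.vars.Nonempty := Finset.nonempty_iff_ne_empty.2 fun h =>
    hf ⟨coeff 0 f, (vars_eq_empty_iff_eq_C.1 h).symm⟩
  exact ⟨f.vars.max' hne, f.vars.isGreatest_max' hne⟩

theorem IsLeader.isAlgReduced (hu : IsLeader g u) (h : f.degreeOf u < g.degreeOf u) :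
    IsAlgReduced f g :=
  fun _ hv => hu.eq hv ▸ h

theorem isAlgReduced_of_notMem_vars (h : ∀ u, IsLeader g u → u ∉ f.vars) :
    IsAlgReduced f g := by
  intro u hu
  have hdeg : f.degreeOf u = 0 := not_not.1 (mt mem_vars_iff_degreeOf_ne_zero.2 (h u hu))
  exact hdeg ▸ hu.degreeOf_pos

theorem IsAlgReduced.mono {f' : MvPolynomial σ k} (hf : IsAlgReduced f g)
    (h : ∀ v, f'.degreeOf v ≤ f.degreeOf v) : IsAlgReduced f' g :=
  fun u hu => (h u).trans_lt (hf u hu)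

end Leader

theorem notMem_range_C_of_mem {σ k : Type*} [Field k] {P : Ideal (MvPolynomial σ k)} (hP : P ≠ ⊤)
    {f : MvPolynomial σ k} (hf : f ∈ P) (hf0 : f ≠ 0) :
    f ∉ Set.range (C : k → MvPolynomial σ k) := by
  rintro ⟨a, rfl⟩
  have ha : IsUnit a := isUnit_iff_ne_zero.2 (C_ne_zero.1 hf0)
  exact hP (P.eq_top_of_isUnit_mem hf (ha.map C))

section CharSet

variable {σ k : Type*} [LinearOrder σ]

/-- The properties shared by algebraic reducedness and differential reducedness on which the basic
facts about characteristic sets rest. -/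
structure IsReducedness [CommRing k] (red : MvPolynomial σ k → MvPolynomial σ k → Prop) :
    Prop where
  isAlgReduced {f g : MvPolynomial σ k} : red f g → IsAlgReduced f g
  of_degreeOf_lt {f g : MvPolynomial σ k} {u : σ} : IsLeader g u → f ∈ supported k (Set.Iic u) →
    f.degreeOf u < g.degreeOf u → red f g
  mono {f f' g : MvPolynomial σ k} : red f g → (∀ v, f'.degreeOf v ≤ f.degreeOf v) → red f' g

theorem isReducedness_isAlgReduced [CommRing k] :
    IsReducedness (IsAlgReduced (σ := σ) (k := k)) where
  isAlgReduced := id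
  of_degreeOf_lt hu _ := hu.isAlgReduced
  mono := IsAlgReduced.mono

/-- The set obtained from `A` by adding `f` and keeping only the elements with leader below `w`.
When `w` is the leader of `f` and `f` is reduced with respect to `A`, it has lower rank than `A`. -/
def insertBelow [CommRing k] (f : MvPolynomial σ k) (w : σ) (A : Set (MvPolynomial σ k)) :
    Set (MvPolynomial σ k) :=
  insert f {c ∈ A | ∃ u < w, IsLeader c u}

theorem IsAutoreducedFor.insertBelow [CommRing k]
    {red : MvPolynomial σ k → MvPolynomial σ k → Prop} (hred : IsReducedness red)
    {A : Set (MvPolynomial σ k)} (hA : IsAutoreducedFor red A) {f : MvPolynomial σ k} {w : σ}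
    (hw : IsLeader f w) (hf : ∀ c ∈ A, red f c) : IsAutoreducedFor red (insertBelow f w A) := by
  constructor
  · rintro g (rfl | hg)
    exacts [hw.notMem_range_C, hA.1 g hg.1]
  · rintro g (rfl | ⟨hg, u, huw, hu⟩) h (rfl | ⟨hh, -⟩) hne
    · exact absurd rfl hne
    · exact hf h hh
    · refine hred.of_degreeOf_lt hw
        (supported_mono (Set.Iic_subset_Iic.2 huw.le) hu.mem_supported) ?_
      rw [hu.degreeOf_eq_zero huw]
      exact hw.degreeOf_pos
    · exact hA.2 g hg h hh hne

theorem lowerRank_insertBelow [CommRing k] {A : Set (MvPolynomial σ k)} {f : MvPolynomial σ k}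
    {w : σ} (hw : IsLeader f w) (hf : ∀ c ∈ A, IsAlgReduced f c) :
    LowerRank (insertBelow f w A) A := by
  refine ⟨(w, f.degreeOf w), ⟨f, Or.inl rfl, hw, rfl⟩, ?_, ?_⟩
  · rintro ⟨c, hc, hcw, hdeg⟩
    exact (hf c hc w hcw).ne hdeg.symm
  · rintro ⟨u, d⟩ hlt
    constructor
    · rintro ⟨g, rfl | hg, hgu, hgd⟩
      · obtain rfl : w = u := hw.eq hgu
        obtain hww | ⟨-, hd⟩ := hlt
        exacts [absurd hww (lt_irrefl w), absurd hgd hd.ne']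
      · exact ⟨g, hg.1, hgu, hgd⟩
    · rintro ⟨c, hc, hcu, hcd⟩
      rcases hlt with huw | ⟨rfl, hd⟩
      · exact ⟨c, Or.inr ⟨hc, u, huw, hcu⟩, hcu, hcd⟩
      · exact absurd (hcd ▸ hf c hc u hcu) hd.not_gt

variable [Field k] {red : MvPolynomial σ k → MvPolynomial σ k → Prop}
  {P Q : Ideal (MvPolynomial σ k)} {A B : Set (MvPolynomial σ k)}

theorem IsCharSetFor.eq_zero_of_forall_red (hred : IsReducedness red) (hP : P ≠ ⊤)
    (hA : IsCharSetFor red A (P : Set (MvPolynomial σ k))) {f : MvPolynomial σ k} (hf : f ∈ P)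
    (hfA : ∀ c ∈ A, red f c) : f = 0 := by
  by_contra hf0
  obtain ⟨w, hw⟩ := exists_isLeader (notMem_range_C_of_mem hP hf hf0)
  obtain ⟨hAP, hauto, hmin⟩ := hA
  have hsub : insertBelow f w A ⊆ P := Set.insert_subset hf ((Set.sep_subset _ _).trans hAP)
  exact hmin _ hsub (hauto.insertBelow hred hw hfA)
    (lowerRank_insertBelow hw fun c hc => hred.isAlgReduced (hfA c hc))

theorem IsCharSetFor.pderiv_leader_notMem [CharZero k] (hred : IsReducedness red) (hP : P ≠ ⊤)
    (hA : IsCharSetFor red A (P : Set (MvPolynomial σ k))) {c : MvPolynomial σ k} (hc : c ∈ A)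
    {u : σ} (hu : IsLeader c u) : pderiv u c ∉ P := by
  intro hmem
  refine pderiv_ne_zero_of_mem_vars hu.1 (hA.eq_zero_of_forall_red hred hP hmem fun c' hc' => ?_)
  obtain rfl | hne := eq_or_ne c c'
  · exact hred.of_degreeOf_lt hu
      (mem_supported.2 fun v hv => hu.2 (vars_pderiv_subset u c hv)) (degreeOf_pderiv_lt hu.1)
  · exact hred.mono (hA.2.1.2 c hc c' hc' hne) fun v => degreeOf_pderiv_le u v c

theorem eq_of_leaders_subset_of_isAlgCharSet [CharZero k] [WellFoundedLT σ] [P.IsPrime]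
    (hQ : Q ≠ ⊤) (hA : IsAlgCharSet A (P : Set (MvPolynomial σ k)))
    (hB : IsAlgCharSet B (Q : Set (MvPolynomial σ k))) (hBA : leaders B ⊆ leaders A)
    (hPQ : P ≤ Q) : P = Q := by
  refine eq_of_le_of_pderiv_notMem hPQ (leaders A)ᶜ (fun v hv => ?_) fun f hf hfN => ?_
  · obtain ⟨c, hc, hcv⟩ := not_not.1 hv
    exact ⟨c, hA.1 hc, hcv.mem_supported,
      hA.pderiv_leader_notMem isReducedness_isAlgReduced (Ideal.IsPrime.ne_top ‹_›) hc hcv⟩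
  · exact hB.eq_zero_of_forall_red isReducedness_isAlgReduced hQ hf fun c hc =>
      isAlgReduced_of_notMem_vars fun u hu hmem => mem_supported.1 hfN hmem (hBA ⟨c, hc, hu⟩)

end CharSet

section Ranking

variable {m n : ℕ}

theorem DVar.zero_act (u : DVar m n) : u.act 0 = u := by
  simp only [DVar.act, zero_add]

theorem DVar.act_act (θ η : Fin m →₀ ℕ) (u : DVar m n) : (u.act θ).act η = u.act (θ + η) := by
  simp only [DVar.act, add_comm θ, add_assoc]

theorem DVar.act_injective (θ : Fin m →₀ ℕ) : Function.Injective (DVar.act (n := n) θ) := by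
  intro u v h
  simp only [DVar.act, DVar.mk.injEq, add_right_inj] at h
  exact DVar.ext h.1 h.2

theorem DVar.act_ne_self {θ : Fin m →₀ ℕ} (hθ : θ ≠ 0) (u : DVar m n) : u.act θ ≠ u :=
  fun h => hθ (add_eq_right.1 (congrArg DVar.op h))

variable [LinearOrder (DVar m n)]

theorem IsRanking.lt_act (h : IsRanking m n) {θ : Fin m →₀ ℕ} (hθ : θ ≠ 0) (u : DVar m n) :
    u < u.act θ :=
  (h.1 θ u).lt_of_ne (DVar.act_ne_self hθ u).symm

theorem IsRanking.wellFoundedLT (h : IsRanking m n) : WellFoundedLT (DVar m n) := by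
  refine ⟨RelEmbedding.wellFounded_iff_isEmpty.2 ⟨fun f => ?_⟩⟩
  -- By Dickson's lemma, a later term of the descending sequence `f` is a derivative of an earlier.
  have hwqo := (wellQuasiOrdered_le (α := Fin m →₀ ℕ)).prod
    (Finite.wellQuasiOrdered (α := Fin n) (· = ·))
  obtain ⟨a, b, hab, hop, hvar⟩ := hwqo fun i => ((f i).op, (f i).var)
  have hact : (f a).act ((f b).op - (f a).op) = f b :=
    DVar.ext (tsub_add_cancel_of_le hop) hvar
  have hle : f a ≤ f b := hact ▸ h.1 _ (f a)
  exact hle.not_gt (f.map_rel_iff.2 hab)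

end Ranking

section Delta

variable {m n : ℕ} {k : Type*} [CommRing k] (D : Fin m → Derivation ℤ k k) (i : Fin m)

theorem delta_mem_supported {s t : Set (DVar m n)} (hst : s ⊆ t)
    (hact : ∀ v ∈ s, v.act (Finsupp.single i 1) ∈ t) {f : DiffPoly m n k}
    (hf : f ∈ supported k s) : delta D i f ∈ supported k t := by
  have hle : supported k s ≤ supported k t := supported_mono hst
  induction hf using Algebra.adjoin_induction with
  | mem g hg =>
    obtain ⟨v, hv, rfl⟩ := hg
    rw [delta_X]
    exact Algebra.subset_adjoin ⟨_, hact v hv, rfl⟩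
  | algebraMap a =>
    rw [algebraMap_eq, delta_C]
    exact Subalgebra.algebraMap_mem _ _
  | add p q _ _ ihp ihq =>
    rw [map_add]
    exact add_mem ihp ihq
  | mul p q hp hq ihp ihq =>
    rw [Derivation.leibniz]
    exact add_mem (mul_mem (hle hp) ihq) (mul_mem (hle hq) ihp)

theorem pderiv_act_delta (u : DVar m n) (f : DiffPoly m n k) :
    pderiv (u.act (Finsupp.single i 1)) (delta D i f) =
      pderiv u f + delta D i (pderiv (u.act (Finsupp.single i 1)) f) := by
  classical
  induction f using MvPolynomial.induction_on with
  | C a => simp only [delta_C, pderiv_C, map_zero, add_zero]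
  | add p q hp hq => simp only [map_add, hp, hq]; ring
  | mul_X p v hp =>
    have hX : pderiv (u.act (Finsupp.single i 1)) (X (v.act (Finsupp.single i 1))) =
        pderiv u (X v : DiffPoly m n k) := by
      simp only [pderiv_X, Pi.single_apply, (DVar.act_injective _).eq_iff]
    have hconst : delta D i (pderiv (u.act (Finsupp.single i 1)) (X v)) = 0 := by
      rw [pderiv_X, Pi.single_apply]
      split_ifs <;> simp only [map_zero, Derivation.map_one_eq_zero]
    simp only [Derivation.leibniz, smul_eq_mul, map_add, delta_X, hp, hX, hconst]
    ring

end Delta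

section DifferentialCharSet

variable {m n : ℕ} [LinearOrder (DVar m n)] {k : Type*}

theorem IsRanking.pderiv_act_delta_eq [CommRing k] (h : IsRanking m n)
    (D : Fin m → Derivation ℤ k k) (i : Fin m) {u : DVar m n} {f : DiffPoly m n k}
    (hf : f ∈ supported k (Set.Iic u)) :
    pderiv (u.act (Finsupp.single i 1)) (delta D i f) = pderiv u f := by
  have hlt : u < u.act (Finsupp.single i 1) :=
    h.lt_act (Finsupp.single_ne_zero.2 one_ne_zero) u
  rw [pderiv_act_delta, pderiv_eq_zero_of_notMem_vars fun hmem =>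
    hlt.not_ge (mem_supported.1 hf hmem), map_zero, add_zero]

/-- Witnessed by `g = θ f`. -/
theorem IsRanking.exists_mem_supported_Iic_act [CommRing k] (h : IsRanking m n)
    {D : Fin m → Derivation ℤ k k} {I : Ideal (DiffPoly m n k)} (hI : IsDifferentialIdeal D I)
    (θ : Fin m →₀ ℕ) {u : DVar m n} {f : DiffPoly m n k} (hfI : f ∈ I)
    (hf : f ∈ supported k (Set.Iic u)) :
    ∃ g ∈ I, g ∈ supported k (Set.Iic (u.act θ)) ∧ pderiv (u.act θ) g = pderiv u f := by
  induction θ using Finsupp.induction_linear generalizing u f with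
  | zero => exact ⟨f, hfI, by rwa [DVar.zero_act], by rw [DVar.zero_act]⟩
  | add θ η ihθ ihη =>
    obtain ⟨g, hgI, hg, hgf⟩ := ihθ hfI hf
    obtain ⟨g', hgI', hg', hgf'⟩ := ihη hgI hg
    rw [DVar.act_act] at hg' hgf'
    exact ⟨g', hgI', hg', hgf'.trans hgf⟩
  | single i d =>
    induction d with
    | zero =>
      rw [Finsupp.single_zero, DVar.zero_act]
      exact ⟨f, hfI, hf, rfl⟩
    | succ d ih =>
      obtain ⟨g, hgI, hg, hgf⟩ := ih
      rw [Finsupp.single_add, ← DVar.act_act]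
      exact ⟨delta D i g, hI i g hgI,
        delta_mem_supported D i (Set.Iic_subset_Iic.2 (h.1 _ _)) (fun v hv => h.2 _ _ v hv) hg,
        (h.pderiv_act_delta_eq D i hg).trans hgf⟩

theorem IsRanking.isReducedness_isReduced [CommRing k] (h : IsRanking m n) :
    IsReducedness (IsReduced (m := m) (n := n) (k := k)) where
  isAlgReduced := And.right
  of_degreeOf_lt {f g u} hu hf hdeg := by
    refine ⟨fun v hv θ hθ hmem => ?_, hu.isAlgReduced hdeg⟩
    obtain rfl := hu.eq hv
    exact (h.lt_act hθ u).not_ge (mem_supported.1 hf hmem)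
  mono {f f' g} hf hdeg := by
    refine ⟨fun u hu θ hθ hmem => hf.1 u hu θ hθ ?_, hf.2.mono hdeg⟩
    rw [mem_vars_iff_degreeOf_ne_zero] at hmem ⊢
    exact ((Nat.pos_of_ne_zero hmem).trans_le (hdeg _)).ne'

theorem isReduced_of_act_notMem_vars [CommRing k] {f g : DiffPoly m n k}
    (hfree : ∀ u, IsLeader g u → ∀ θ, u.act θ ∉ f.vars) : IsReduced f g :=
  ⟨fun u hu θ _ => hfree u hu θ,
    isAlgReduced_of_notMem_vars fun u hu => DVar.zero_act u ▸ hfree u hu 0⟩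

theorem IsRanking.eq_of_leaders_subset_of_isCharSet [Field k] [CharZero k] (h : IsRanking m n)
    {D : Fin m → Derivation ℤ k k} {P Q : Ideal (DiffPoly m n k)} [P.IsPrime] (hQ : Q ≠ ⊤)
    (hPD : IsDifferentialIdeal D P) {A B : Set (DiffPoly m n k)}
    (hA : IsCharSet A (P : Set (DiffPoly m n k))) (hB : IsCharSet B (Q : Set (DiffPoly m n k)))
    (hBA : leaders B ⊆ leaders A) (hPQ : P ≤ Q) : P = Q := by
  have := h.wellFoundedLT
  let N : Set (DVar m n) := {v | ∃ u ∈ leaders A, ∃ θ, u.act θ = v}ᶜ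
  refine eq_of_le_of_pderiv_notMem hPQ N (fun v hv => ?_) fun f hf hfN => ?_
  · obtain ⟨u, ⟨c, hc, hcu⟩, θ, rfl⟩ := not_not.1 hv
    obtain ⟨g, hgP, hg, hgc⟩ := h.exists_mem_supported_Iic_act hPD θ (hA.1 hc) hcu.mem_supported
    refine ⟨g, hgP, hg, hgc ▸ ?_⟩
    exact hA.pderiv_leader_notMem h.isReducedness_isReduced (Ideal.IsPrime.ne_top ‹_›) hc hcu
  · exact hB.eq_zero_of_forall_red h.isReducedness_isReduced hQ hf fun c hc =>
      isReduced_of_act_notMem_vars fun u hu θ hmem =>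
        mem_supported.1 hfN hmem ⟨u, hBA ⟨c, hc, hu⟩, θ, rfl⟩

end DifferentialCharSet

end DiffAlg

theorem lemmal_general {k : Type*} [Field k] [CharZero k] {m n : ℕ}
    (D : Fin m → Derivation ℤ k k)
    [LinearOrder (DiffAlg.DVar m n)] (hrank : DiffAlg.IsRanking m n) :
    (∀ P Q : Ideal (DiffAlg.DiffPoly m n k), P.IsPrime → Q ≠ ⊤ →
      DiffAlg.IsDifferentialIdeal D P →
      ∀ C₁ C₂ : Set (DiffAlg.DiffPoly m n k),
        DiffAlg.IsCharSet C₁ (P : Set (DiffAlg.DiffPoly m n k)) →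
        DiffAlg.IsCharSet C₂ (Q : Set (DiffAlg.DiffPoly m n k)) →
        DiffAlg.leaders C₂ ⊆ DiffAlg.leaders C₁ → P ≤ Q → P = Q) ∧
    (∀ (σ : Type*) [LinearOrder σ] [WellFoundedLT σ] (P Q : Ideal (MvPolynomial σ k)),
      P.IsPrime → Q ≠ ⊤ →
      ∀ C₁ C₂ : Set (MvPolynomial σ k),
        DiffAlg.IsAlgCharSet C₁ (P : Set (MvPolynomial σ k)) →
        DiffAlg.IsAlgCharSet C₂ (Q : Set (MvPolynomial σ k)) →
        DiffAlg.leaders C₂ ⊆ DiffAlg.leaders C₁ → P ≤ Q → P = Q) :=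
  ⟨fun _ _ _ hQ hPD _ _ h₁ h₂ => hrank.eq_of_leaders_subset_of_isCharSet hQ hPD h₁ h₂,
    fun _ _ _ _ _ _ hQ _ _ => DiffAlg.eq_of_leaders_subset_of_isAlgCharSet hQ⟩

theorem lemmal {k : Type*} [Field k] [CharZero k] {m n : ℕ}
    (D : Fin m → Derivation ℤ k k) (hD : ∀ i j a, D i (D j a) = D j (D i a))
    [LinearOrder (DiffAlg.DVar m n)] (hrank : DiffAlg.IsRanking m n) :
    -- differential ideals of `k{y_1, …, y_n}`
    (∀ P Q : Ideal (DiffAlg.DiffPoly m n k), P.IsPrime → Q.IsPrime →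
      DiffAlg.IsDifferentialIdeal D P → DiffAlg.IsDifferentialIdeal D Q →
      ∀ C₁ C₂ : Set (DiffAlg.DiffPoly m n k),
        DiffAlg.IsCharSet C₁ (P : Set (DiffAlg.DiffPoly m n k)) →
        DiffAlg.IsCharSet C₂ (Q : Set (DiffAlg.DiffPoly m n k)) →
        DiffAlg.leaders C₁ = DiffAlg.leaders C₂ → P ≤ Q → P = Q) ∧
    -- algebraic ideals of `k[V]`, for any set `V` of derivatives, ordered by the ranking
    (∀ (V : Set (DiffAlg.DVar m n)) (P Q : Ideal (MvPolynomial V k)), P.IsPrime → Q.IsPrime →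
      ∀ C₁ C₂ : Set (MvPolynomial V k),
        DiffAlg.IsAlgCharSet C₁ (P : Set (MvPolynomial V k)) →
        DiffAlg.IsAlgCharSet C₂ (Q : Set (MvPolynomial V k)) →
        DiffAlg.leaders C₁ = DiffAlg.leaders C₂ → P ≤ Q → P = Q) := by
  have := hrank.wellFoundedLT
  obtain ⟨hdiff, halg⟩ := lemmal_general D hrank
  exact ⟨fun P Q hP hQ hPD _ C₁ C₂ h₁ h₂ hL => hdiff P Q hP hQ.ne_top hPD C₁ C₂ h₁ h₂ hL.ge,
    fun V P Q hP hQ C₁ C₂ h₁ h₂ hL => halg V P Q hP hQ.ne_top C₁ C₂ h₁ h₂ hL.ge⟩
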